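/- All graphs are finite and simple. The treewidth $\mathrm{tw}(G)$ is the minimum, over all tree decompositions of $G$, of the maximum bag size minus one; $\omega(G)$ is the maximum size of a clique of $G$; a hole is an induced cycle of length at least $4$; a graph is $d$-degenerate if each of its nonempty induced subgraphs has a vertex of degree at most $d$. **Theorem.** For all integers $\ell\ge 5$, $c\ge 2$ and $t\ge 1$ there is a graph $G$ with $\mathrm{tw}(G)\ge t$, and with $\mathrm{tw}(G)=t$ exactly if moreover $t\ge c$, such that 1. $\omega(G)=c+1$; 2. every hole of $G$ has length at least $\ell$, and no induced subgraph of $G$ is a complete bipartite graph of treewidth at least $2$; 3. every $K_c$-free induced subgraph of $G$ has treewidth at most $15\bigl(c+(\ell+1)(c-1)-2\bigr)$; in particular so does every $(c-2)$-degenerate induced subgraph of $G$. Consequently two conjectures of Hajebi are false, also in the following generalized forms (the original ones are $c=4$ and $d=2$): * for every $c\ge 4$, it is not true that for each $t\ge 1$ every graph of large enough treewidth has an induced subgraph of treewidth $t$ which is either complete or $K_c$-free; * for every $d\ge 2$, it is not true that for each $t\ge 1$ every graph of large enough treewidth has an induced subgraph of treewidth $t$ which is either complete, complete bipartite, or $d$-degenerate.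 -/

import Mathlib

namespace SimpleGraph

universe u

/-- A tree decomposition of a (finite) graph `G`: a finite tree each of whose nodes carries a bag
of vertices of `G`, such that every vertex is in some bag, both ends of every edge are in a common
bag, and for each vertex the nodes whose bags contain it induce a connected subgraph of the tree. -/
structure TreeDecomposition {V : Type u} (G : SimpleGraph V) where
  Node : Type
  finite_node : Finite Node
  tree : SimpleGraph Node
  isTree : tree.IsTree
  bag : Node → Set V
  exists_mem_bag : ∀ v : V, ∃ s : Node, v ∈ bag s
  exists_adj_bag : ∀ u v : V, G.Adj u v → ∃ s : Node, u ∈ bag s ∧ v ∈ bag s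
  connected_bags : ∀ v : V, (tree.induce {s : Node | v ∈ bag s}).Connected

/-- The width of a tree decomposition: the maximum of `|bag s| - 1` over all nodes `s`.
(Subtraction is truncated, which only affects empty bags.) -/
noncomputable def TreeDecomposition.width {V : Type u} {G : SimpleGraph V}
    (D : TreeDecomposition G) : ℕ∞ :=
  ⨆ s : D.Node, ((D.bag s).encard - 1)

/-- The treewidth of a graph: the minimum width of a tree decomposition. It is `0` for the graph
with no vertices. -/
noncomputable def treewidth {V : Type u} (G : SimpleGraph V) : ℕ∞ :=
  ⨅ D : TreeDecomposition G, D.width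

/-- `G` has a hole (an induced cycle of length at least `4`) of length `m`. -/
def HasHoleOfLength {V : Type u} (G : SimpleGraph V) (m : ℕ) : Prop :=
  4 ≤ m ∧ cycleGraph m ⊴ G

/-- `G` is `d`-degenerate: every (nonempty) induced subgraph `G[S]` has a vertex whose degree in
`G[S]` is at most `d`. -/
def IsDegenerate {V : Type u} (G : SimpleGraph V) (d : ℕ) : Prop :=
  ∀ S : Set V, S.Nonempty → ∃ v ∈ S, (G.neighborSet v ∩ S).encard ≤ d

/-- `G` is isomorphic to a complete bipartite graph `K_{a,b}`. -/
def IsCompleteBipartiteGraph {V : Type u} (G : SimpleGraph V) : Prop :=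
  ∃ a b : ℕ, Nonempty (G ≃g completeBipartiteGraph (Fin a) (Fin b))

/-- For every `t ≥ 1`, every finite graph of large enough treewidth has an induced subgraph of
treewidth `t` which is either complete or `K_c`-free. Hajebi conjectured this for `c = 4`. -/
def HajebiCliqueConjecture (c : ℕ) : Prop :=
  ∀ t : ℕ, 1 ≤ t → ∃ N : ℕ, ∀ (V : Type) [Finite V] (G : SimpleGraph V),
    (N : ℕ∞) ≤ G.treewidth →
      ∃ S : Set V, (G.induce S).treewidth = (t : ℕ∞) ∧
        (G.induce S = ⊤ ∨ (G.induce S).CliqueFree c)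

/-- For every `t ≥ 1`, every finite graph of large enough treewidth has an induced subgraph of
treewidth `t` which is complete, complete bipartite or `d`-degenerate. Hajebi conjectured this for
`d = 2`. -/
def HajebiDegenerateConjecture (d : ℕ) : Prop :=
  ∀ t : ℕ, 1 ≤ t → ∃ N : ℕ, ∀ (V : Type) [Finite V] (G : SimpleGraph V),
    (N : ℕ∞) ≤ G.treewidth →
      ∃ S : Set V, (G.induce S).treewidth = (t : ℕ∞) ∧
        (G.induce S = ⊤ ∨ (G.induce S).IsCompleteBipartiteGraph ∨ (G.induce S).IsDegenerate d)

end SimpleGraph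

/-! The graph is a finite induced subgraph of a layered tree. Each layer is a path, the `ℓ * 2 ^ T`
children of a vertex are consecutive on the next layer, and a vertex may also be joined to some of
its ancestors. These ancestors form a set of size at most `c` inside the trunk of its parent (the
parent with its own ancestor neighbours), so every trunk is a clique. Conversely, every such set
with levels below `T` is realised by a child, and only positions divisible by `ℓ` have ancestor
neighbours.

Contracting `T` layers gives a complete minor, so the treewidth is at least `T - 1`, while cliques
have at most `c + 1` vertices. In a hole, the rightmost vertex of the deepest layer has an ancestor
neighbour and its left neighbour on the hole, because ancestor neighbours are pairwise adjacent;
from there the hole must follow the path until the next multiple of `ℓ`.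

Let `S` be `K_c`-free. The part of a trunk in `S` has fewer than `c` vertices, so some child is
joined to exactly that part. Iterating such children down to level `T` traces a curve, and the at
most `c - 1` vertices of `S` in the last trunk separate its left from its right. Two consecutive
curves of one level, with two of the level above, form a bag of size at most `4 * (c - 1)`
(`Sparse.treewidth_induce_le`), whatever `T` is.

Both conjectures then fail: complete subgraphs have bounded treewidth, `d`-degenerate ones are
`K_{d+2}`-free, and complete bipartite ones of treewidth at least 2 contain a hole of length 4. -/

namespace SimpleGraph

/-! ### Subtrees of a rooted tree -/

section Helly

variable {N : Type*} {T : SimpleGraph N}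

theorem IsTree.eq_of_adj_of_dist_lt (hT : T.IsTree) (r : N) {x y z : N} (hy : T.Adj x y)
    (hz : T.Adj x z) (hyx : T.dist r y < T.dist r x) (hzx : T.dist r z < T.dist r x) : y = z := by
  obtain ⟨p, hp, hpl⟩ := hT.connected.exists_path_of_dist r x
  have key : ∀ w, T.Adj x w → T.dist r w < T.dist r x → w = p.penultimate := by
    intro w hw hwx
    refine hT.isAcyclic.eq_penultimate_of_adj_end hp hw ?_
    obtain ⟨q, hq, hql⟩ := hT.connected.exists_path_of_dist r w
    refine hT.isAcyclic.mem_support_of_ne_mem_support_of_adj_of_isPath hp hq hw ?_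
    classical
    intro hx
    have h1 := T.dist_le (q.takeUntil x hx)
    have h2 := q.length_takeUntil_le_length hx
    omega
  rw [key y hy hyx, key z hz hzx]

/-- A path that steps away from the root never turns back: the only neighbour closer to the root is
the vertex just left. -/
theorem IsTree.dist_le_of_isPath_cons (hT : T.IsTree) (r : N) {x y z : N} (h : T.Adj z x)
    (p : T.Walk x y) (hp : (Walk.cons h p).IsPath) (hzx : T.dist r z < T.dist r x) :
    T.dist r x ≤ T.dist r y := by
  induction p generalizing z with
  | nil => exact le_rfl
  | cons h' p ih =>
    rename_i a b c
    have hlt : T.dist r a < T.dist r b := by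
      rcases lt_trichotomy (T.dist r a) (T.dist r b) with hlt | heq | hgt
      · exact hlt
      · exact absurd heq (hT.dist_ne_of_adj r h')
      · have : z = b := hT.eq_of_adj_of_dist_lt r h.symm h' hzx hgt
        subst this
        simp [Walk.cons_isPath_iff] at hp
    exact hlt.le.trans (ih h' hp.of_cons hlt)

theorem IsTree.exists_adj_mem_dist_lt (hT : T.IsTree) (r : N) {C : Set N}
    (hC : (T.induce C).Connected) {x y : N} (hx : x ∈ C) (hy : y ∈ C) (hne : x ≠ y)
    (hle : T.dist r y ≤ T.dist r x) : ∃ z ∈ C, T.Adj x z ∧ T.dist r z < T.dist r x := by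
  obtain ⟨p, hp⟩ := (hC.preconnected ⟨x, hx⟩ ⟨y, hy⟩).exists_isPath
  have hp' : (p.map (Embedding.induce C).toHom).IsPath :=
    hp.map Subtype.val_injective
  cases p with
  | nil => exact absurd rfl hne
  | @cons _ b _ h q =>
    refine ⟨b, b.2, h, ?_⟩
    by_contra hlt
    have hlt' : T.dist r x < T.dist r (b : N) :=
      lt_of_le_of_ne (not_lt.1 hlt) (hT.dist_ne_of_adj r h)
    have := hT.dist_le_of_isPath_cons r h (q.map (Embedding.induce C).toHom) hp' hlt'
    exact absurd (this.trans hle) (not_le.2 hlt')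

/-- The Helly property of the subtrees of a tree. -/
theorem IsTree.exists_forall_mem (hT : T.IsTree) {ι : Type*} [Finite ι] (C : ι → Set N)
    (hC : ∀ i, (T.induce (C i)).Connected) (hint : ∀ i j, (C i ∩ C j).Nonempty) :
    ∃ s, ∀ i, s ∈ C i := by
  obtain ⟨r⟩ := hT.connected.nonempty
  cases isEmpty_or_nonempty ι
  · exact ⟨r, isEmptyElim⟩
  have htop : ∀ i, ∃ t ∈ C i, ∀ x ∈ C i, T.dist r t ≤ T.dist r x := fun i ↦ by
    obtain ⟨x⟩ := (hC i).nonempty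
    exact exists_minimalFor_of_wellFoundedLT (· ∈ C i) (T.dist r) ⟨x, x.2⟩ |>.imp
      fun t ht ↦ ⟨ht.1, fun x hx ↦ (le_total _ _).elim id (ht.2 hx)⟩
  choose t htC htmin using htop
  -- The top node farthest from the root lies in every set: from a common node of `C i` and `C j`,
  -- stepping to the parent stays in both until `t i` is reached.
  obtain ⟨i, hi⟩ := Finite.exists_max fun i ↦ T.dist r (t i)
  refine ⟨t i, fun j ↦ ?_⟩
  obtain ⟨x, hxi, hxj⟩ := hint i j
  induction hd : T.dist r x using Nat.strong_induction_on generalizing x with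
  | _ n ih =>
    by_cases hx : x = t i
    · exact hx ▸ hxj
    obtain ⟨z, hz, hxz, hlt⟩ := hT.exists_adj_mem_dist_lt r (hC i) hxi (htC i) hx (htmin i x hxi)
    have hxt : x ≠ t j := by
      rintro rfl
      have := htmin i z hz
      have := hi j
      omega
    obtain ⟨z', hz', hxz', hlt'⟩ := hT.exists_adj_mem_dist_lt r (hC j) hxj (htC j) hxt
      ((hi j).trans (htmin i x hxi))
    obtain rfl := hT.eq_of_adj_of_dist_lt r hxz hxz' hlt hlt'
    exact ih _ (hd ▸ hlt) z hz hz' rfl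

end Helly

/-! ### Tree decompositions from parent functions -/

section ParentFunction

variable {N : Type*}

/-- The graph joining each node other than the root to its parent. -/
def parentGraph (parent : N → N) : SimpleGraph N :=
  fromRel fun a b ↦ parent a = b

theorem parentGraph_adj_parent {parent : N → N} {s : N} (h : parent s ≠ s) :
    (parentGraph parent).Adj s (parent s) := by
  simp [parentGraph, h.symm]

theorem isTree_parentGraph [Finite N] {parent : N → N} {root : N} {depth : N → ℕ}
    (hroot : parent root = root) (hdepth : ∀ s, s ≠ root → depth (parent s) < depth s) :
    (parentGraph parent).IsTree := by
  have hne : ∀ s, s ≠ root → parent s ≠ s := fun s hs h ↦ by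
    have := hdepth s hs
    rw [h] at this
    exact lt_irrefl _ this
  have hconn : (parentGraph parent).Connected := by
    rw [connected_iff_exists_forall_reachable]
    refine ⟨root, fun s ↦ ?_⟩
    induction hd : depth s using Nat.strong_induction_on generalizing s with
    | _ n ih =>
      by_cases hs : s = root
      · rw [hs]
      · exact (ih _ (hd ▸ hdepth s hs) _ rfl).trans
          (parentGraph_adj_parent (hne s hs)).reachable.symm
  rw [isTree_iff_connected_and_card]
  refine ⟨hconn, le_antisymm ?_ hconn.card_vert_le_card_edgeSet_add_one⟩
  -- Each edge joins a non-root node to its parent, so there are too few edges for a cycle.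
  have hsub : (parentGraph parent).edgeSet ⊆ (fun s ↦ s(s, parent s)) '' {root}ᶜ := by
    intro e
    induction e with
    | _ a b =>
      simp only [mem_edgeSet, parentGraph, fromRel_adj]
      rintro ⟨hab, rfl | rfl⟩
      · exact ⟨a, fun h ↦ hab (by rw [Set.mem_singleton_iff.1 h, hroot]), rfl⟩
      · exact ⟨b, fun h ↦ hab (by rw [Set.mem_singleton_iff.1 h, hroot]), Sym2.eq_swap⟩
  have h1 : Nat.card (parentGraph parent).edgeSet ≤ ({root}ᶜ : Set N).ncard :=
    (Set.ncard_le_ncard hsub (Set.toFinite _)).trans (Set.ncard_image_le (Set.toFinite _))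
  have h2 := Set.ncard_add_ncard_compl ({root} : Set N)
  rw [Set.ncard_singleton] at h2
  omega

/-- A tree decomposition described by a parent function on a finite set of nodes: the nodes whose
bags contain `v` are the node `top v` and nodes whose parent's bag contains `v`. -/
theorem treewidth_le_of_parent {V : Type*} {G : SimpleGraph V} {N : Type} [Finite N]
    {parent : N → N} {root : N} {depth : N → ℕ} (hroot : parent root = root)
    (hdepth : ∀ s, s ≠ root → depth (parent s) < depth s) (bag : N → Set V) (top : V → N)
    (htop : ∀ v, v ∈ bag (top v))
    (hbag : ∀ v s, v ∈ bag s → s ≠ top v → s ≠ root ∧ v ∈ bag (parent s))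
    (hadj : ∀ u v, G.Adj u v → ∃ s, u ∈ bag s ∧ v ∈ bag s) {k : ℕ}
    (hk : ∀ s, (bag s).encard ≤ k + 1) : G.treewidth ≤ k := by
  let D : TreeDecomposition G :=
    { Node := N
      finite_node := inferInstance
      tree := parentGraph parent
      isTree := isTree_parentGraph hroot hdepth
      bag := bag
      exists_mem_bag := fun v ↦ ⟨_, htop v⟩
      exists_adj_bag := hadj
      connected_bags := fun v ↦ by
        rw [connected_iff_exists_forall_reachable]
        refine ⟨⟨top v, htop v⟩, fun ⟨s, hs⟩ ↦ ?_⟩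
        induction hd : depth s using Nat.strong_induction_on generalizing s with
        | _ n ih =>
          by_cases hst : s = top v
          · subst hst; rfl
          · obtain ⟨hsr, hp⟩ := hbag v s hs hst
            have hlt := hdepth s hsr
            refine (ih _ (hd ▸ hlt) _ hp rfl).trans (Adj.reachable ?_).symm
            exact parentGraph_adj_parent fun (h : parent s = s) ↦ by rw [h] at hlt; exact lt_irrefl _ hlt }
  refine (iInf_le _ D).trans (iSup_le fun s ↦ ?_)
  exact tsub_le_iff_right.2 (hk s)

end ParentFunction

/-! ### General bounds on treewidth -/

section Treewidth

variable {V W : Type*} {G : SimpleGraph V} {H : SimpleGraph W}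

/-- The tree is a star: the centre has bag `A`, the leaf of `v` has bag `A ∪ {v}`. -/
theorem treewidth_le_of_vertexCover {W : Type} [Finite W] {H : SimpleGraph W}
    (A : Set W) {k : ℕ} (hA : A.encard ≤ k)
    (h : ∀ u v, H.Adj u v → u ∈ A ∨ v ∈ A) : H.treewidth ≤ k := by
  classical
  refine treewidth_le_of_parent (N := Option W) (parent := fun _ ↦ none) (root := none)
    (depth := fun s ↦ s.elim 0 fun _ ↦ 1) rfl ?_ (fun s ↦ s.elim A fun v ↦ insert v A)
    (fun v ↦ if v ∈ A then none else some v) ?_ ?_ ?_ ?_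
  · rintro (_ | s) hs
    · exact absurd rfl hs
    · simp
  · intro v
    by_cases hv : v ∈ A <;> simp [hv]
  · rintro v (_ | s) hs hne
    · by_cases hv : v ∈ A
      · simp [hv] at hne
      · exact absurd hs hv
    · refine ⟨by simp, ?_⟩
      by_cases hv : v ∈ A
      · exact hv
      · rcases hs with rfl | hs
        · simp [hv] at hne
        · exact hs
  · intro u v huv
    rcases h u v huv with hu | hv
    · exact ⟨some v, by simp [hu]⟩
    · exact ⟨some u, by simp [hv]⟩
  · rintro (_ | s)
    · exact hA.trans (by simp)
    · exact (Set.encard_insert_le _ _).trans (by gcongr)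

theorem exists_treeDecomposition_width_eq [Nonempty (TreeDecomposition G)] :
    ∃ D : TreeDecomposition G, D.width = G.treewidth :=
  ciInf_mem fun D : TreeDecomposition G ↦ D.width

/-- The tree decomposition of a graph which consists of a single bag. -/
def TreeDecomposition.single (G : SimpleGraph V) : TreeDecomposition G where
  Node := Unit
  finite_node := inferInstance
  tree := ⊥
  isTree := IsTree.of_subsingleton
  bag := fun _ ↦ Set.univ
  exists_mem_bag := fun _ ↦ ⟨(), trivial⟩
  exists_adj_bag := fun _ _ _ ↦ ⟨(), trivial, trivial⟩
  connected_bags := fun v ↦ by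
    have : Nonempty {s : Unit | v ∈ Set.univ} := ⟨⟨(), trivial⟩⟩
    exact (IsTree.of_subsingleton).connected

theorem treewidth_le_encard_sub_one (G : SimpleGraph V) :
    G.treewidth ≤ (Set.univ : Set V).encard - 1 :=
  (iInf_le _ (TreeDecomposition.single G)).trans (iSup_le fun _ ↦ le_rfl)

/-- The treewidth does not increase when passing to a subgraph. -/
theorem treewidth_le_of_injective (f : H →g G) (hf : Function.Injective f) :
    H.treewidth ≤ G.treewidth := by
  refine le_iInf fun D ↦ ?_
  let D' : TreeDecomposition H :=
    { Node := D.Node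
      finite_node := D.finite_node
      tree := D.tree
      isTree := D.isTree
      bag := fun s ↦ f ⁻¹' D.bag s
      exists_mem_bag := fun v ↦ D.exists_mem_bag (f v)
      exists_adj_bag := fun u v h ↦ D.exists_adj_bag _ _ (f.map_adj h)
      connected_bags := fun v ↦ D.connected_bags (f v) }
  refine (iInf_le _ D').trans (iSup_mono fun s ↦ ?_)
  gcongr
  rw [← hf.encard_image]
  exact Set.encard_le_encard (Set.image_preimage_subset f _)

theorem treewidth_eq_of_iso (e : H ≃g G) : H.treewidth = G.treewidth :=
  le_antisymm (treewidth_le_of_injective e.toHom e.injective)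
    (treewidth_le_of_injective e.symm.toHom e.symm.injective)

theorem treewidth_induce_mono {S S' : Set V} (h : S ⊆ S') :
    (G.induce S).treewidth ≤ (G.induce S').treewidth :=
  treewidth_le_of_injective (induceHomOfLE G h).toHom (induceHomOfLE G h).injective

/-- Deleting a vertex decreases the treewidth by at most one. -/
theorem treewidth_induce_le_induce_diff_singleton_add_one (S : Set V) (v : V) :
    (G.induce S).treewidth ≤ (G.induce (S \ {v})).treewidth + 1 := by
  by_cases hv : v ∈ S
  swap
  · rw [Set.sdiff_singleton_eq_self hv]
    exact le_self_add
  have : Nonempty (TreeDecomposition (G.induce (S \ {v}))) := ⟨.single _⟩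
  obtain ⟨D, hD⟩ := exists_treeDecomposition_width_eq (G := G.induce (S \ {v}))
  rw [← hD]
  let b : D.Node → Set S := fun s ↦ insert ⟨v, hv⟩ (Set.inclusion Set.sdiff_subset '' D.bag s)
  have hb : ∀ (u : S) (hu : (u : V) ≠ v) s, u ∈ b s ↔ ⟨u, u.2, hu⟩ ∈ D.bag s := by
    intro u hu s
    constructor
    · rintro (rfl | ⟨w, hw, rfl⟩)
      · exact absurd rfl hu
      · exact hw
    · exact fun h ↦ Or.inr ⟨_, h, rfl⟩
  have hb' : ∀ (u : S) (hu : (u : V) = v) s, u ∈ b s := fun u hu s ↦ Or.inl (Subtype.ext hu)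
  let D' : TreeDecomposition (G.induce S) :=
    { Node := D.Node
      finite_node := D.finite_node
      tree := D.tree
      isTree := D.isTree
      bag := b
      exists_mem_bag := fun u ↦ by
        by_cases hu : (u : V) = v
        · exact ⟨D.isTree.connected.nonempty.some, hb' u hu _⟩
        · exact (D.exists_mem_bag ⟨u, u.2, hu⟩).imp fun s hs ↦ (hb u hu s).2 hs
      exists_adj_bag := fun u w h ↦ by
        by_cases hu : (u : V) = v
        · have hw : (w : V) ≠ v := fun hw ↦ G.ne_of_adj h (hu.trans hw.symm)
          exact (D.exists_mem_bag ⟨w, w.2, hw⟩).imp fun s hs ↦ ⟨hb' u hu s, (hb w hw s).2 hs⟩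
        · by_cases hw : (w : V) = v
          · exact (D.exists_mem_bag ⟨u, u.2, hu⟩).imp fun s hs ↦ ⟨(hb u hu s).2 hs, hb' w hw s⟩
          · exact (D.exists_adj_bag ⟨u, u.2, hu⟩ ⟨w, w.2, hw⟩ h).imp fun s hs ↦
              ⟨(hb u hu s).2 hs.1, (hb w hw s).2 hs.2⟩
      connected_bags := fun u ↦ by
        by_cases hu : (u : V) = v
        · have : {s | u ∈ b s} = Set.univ := Set.eq_univ_of_forall fun s ↦ hb' u hu s
          rw [this]
          exact (Iso.connected_iff (induceUnivIso D.tree)).2 D.isTree.connected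
        · have : {s | u ∈ b s} = {s | ⟨u, u.2, hu⟩ ∈ D.bag s} := Set.ext fun s ↦ hb u hu s
          rw [this]
          exact D.connected_bags _ }
  refine (iInf_le _ D').trans (iSup_le fun s ↦ ?_)
  have h1 : (b s).encard ≤ (D.bag s).encard + 1 :=
    (Set.encard_insert_le _ _).trans (by gcongr; exact Set.encard_image_le _ _)
  have h2 : (D.bag s).encard - 1 ≤ D.width := le_iSup (fun s ↦ (D.bag s).encard - 1) s
  exact tsub_le_iff_right.2 (h1.trans (by gcongr; exact tsub_le_iff_right.1 h2))

/-- Every treewidth between those of `G[A]` and of `G[B]` is that of some `G[S]` with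
`A ⊆ S ⊆ B`. -/
theorem exists_treewidth_induce_eq {A B : Set V} (hB : B.Finite) (hAB : A ⊆ B) {t : ℕ}
    (hA : (G.induce A).treewidth ≤ t) (ht : (t : ℕ∞) ≤ (G.induce B).treewidth) :
    ∃ S, A ⊆ S ∧ S ⊆ B ∧ (G.induce S).treewidth = t := by
  have hfin : {S : Set V | S ⊆ B ∧ A ⊆ S ∧ (t : ℕ∞) ≤ (G.induce S).treewidth}.Finite :=
    hB.finite_subsets.subset fun S hS ↦ hS.1
  -- By minimality, deleting a vertex outside `A` brings the treewidth below `t`, and a deletion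
  -- costs at most one.
  obtain ⟨S, hS⟩ := hfin.exists_minimal ⟨B, subset_rfl, hAB, ht⟩
  refine ⟨S, hS.prop.2.1, hS.prop.1, le_antisymm ?_ hS.prop.2.2⟩
  by_cases h : ∃ v ∈ S, v ∉ A
  · obtain ⟨v, hv, hvA⟩ := h
    have hlt : (G.induce (S \ {v})).treewidth < t := by
      by_contra hle
      have := hS.le_of_le (y := S \ {v}) ⟨Set.sdiff_subset.trans hS.prop.1,
        Set.subset_sdiff_singleton hS.prop.2.1 hvA, not_lt.1 hle⟩ Set.sdiff_subset
      exact (this hv).2 rfl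
    exact (treewidth_induce_le_induce_diff_singleton_add_one S v).trans (Order.add_one_le_of_lt hlt)
  · push Not at h
    exact (treewidth_induce_mono h).trans hA

/-- Pairwise disjoint and pairwise touching connected sets bound the treewidth from below. -/
theorem card_le_treewidth_add_one {ι : Type*} [Finite ι] (B : ι → Set V)
    (hconn : ∀ i, (G.induce (B i)).Connected) (hdisj : ∀ i j, i ≠ j → Disjoint (B i) (B j))
    (htouch : ∀ i j, i ≠ j → ∃ u ∈ B i, ∃ v ∈ B j, G.Adj u v) :
    (ENat.card ι : ℕ∞) ≤ G.treewidth + 1 := by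
  have : Nonempty (TreeDecomposition G) := ⟨.single _⟩
  obtain ⟨D, hD⟩ := exists_treeDecomposition_width_eq (G := G)
  rw [← hD]
  -- The nodes whose bags meet `B i` form a subtree. By the Helly property one bag meets every `B
  -- i`, in distinct vertices by disjointness.
  let C : ι → Set D.Node := fun i ↦ {s | ∃ v ∈ B i, v ∈ D.bag s}
  have hC : ∀ i, (D.tree.induce (C i)).Connected := by
    intro i
    obtain ⟨⟨v, hv⟩⟩ := (hconn i).nonempty
    obtain ⟨s, hs⟩ := D.exists_mem_bag v
    have hsub : ∀ w ∈ B i, {s | w ∈ D.bag s} ⊆ C i := fun w hw s hs ↦ ⟨w, hw, hs⟩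
    have hreach : ∀ w (hw : w ∈ B i) a b (ha : w ∈ D.bag a) (hb : w ∈ D.bag b),
        (D.tree.induce (C i)).Reachable ⟨a, w, hw, ha⟩ ⟨b, w, hw, hb⟩ := fun w hw a b ha hb ↦
      ((D.connected_bags w).preconnected ⟨a, ha⟩ ⟨b, hb⟩).map (induceHomOfLE _ (hsub w hw)).toHom
    rw [connected_iff_exists_forall_reachable]
    refine ⟨⟨s, v, hv, hs⟩, fun ⟨s', w, hw, hs'⟩ ↦ ?_⟩
    obtain ⟨p⟩ := (hconn i).preconnected ⟨v, hv⟩ ⟨w, hw⟩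
    have key : ∀ (x y : B i) (_ : (G.induce (B i)).Walk x y) (a b : D.Node)
        (ha : (x : V) ∈ D.bag a) (hb : (y : V) ∈ D.bag b),
        (D.tree.induce (C i)).Reachable ⟨a, x, x.2, ha⟩ ⟨b, y, y.2, hb⟩ := by
      intro x y q
      induction q with
      | nil => exact fun a b ha hb ↦ hreach _ (Subtype.prop _) a b ha hb
      | cons h q ih =>
        rename_i x x' y
        intro a b ha hb
        obtain ⟨d, hd, hd'⟩ := D.exists_adj_bag _ _ h
        exact (hreach _ x.2 a d ha hd).trans (ih d b hd' hb)
    exact key _ _ p s s' hs hs'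
  have hint : ∀ i j, (C i ∩ C j).Nonempty := by
    intro i j
    by_cases hij : i = j
    · subst hij
      obtain ⟨x⟩ := (hC i).nonempty
      exact ⟨x, x.2, x.2⟩
    · obtain ⟨u, hu, v, hv, huv⟩ := htouch i j hij
      obtain ⟨s, hs, hs'⟩ := D.exists_adj_bag u v huv
      exact ⟨s, ⟨u, hu, hs⟩, ⟨v, hv, hs'⟩⟩
  obtain ⟨s, hs⟩ := D.isTree.exists_forall_mem C hC hint
  choose f hfB hfs using hs
  have hf : Function.Injective f := by
    intro i j hij
    by_contra hne
    exact Set.disjoint_left.1 (hdisj i j hne) (hfB i) (hij ▸ hfB j)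
  have h1 : ENat.card ι ≤ (D.bag s).encard := by
    rw [← Set.encard_univ, ← hf.encard_image]
    exact Set.encard_le_encard (by rintro _ ⟨i, -, rfl⟩; exact hfs i)
  refine h1.trans ?_
  have h2 : (D.bag s).encard - 1 ≤ D.width := le_iSup (fun s ↦ (D.bag s).encard - 1) s
  exact tsub_le_iff_right.1 h2

end Treewidth

/-! ### The layered tree -/

namespace LayeredTree

variable {ℓ c T : ℕ}

/-- The number of children of each vertex. -/
def branching (ℓ T : ℕ) : ℕ := ℓ * 2 ^ T

/-- The code of a set of levels. -/
def code (A : Finset ℕ) : ℕ := Finset.equivBitIndices.symm A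

/-- The set of levels encoded by the position of a vertex among its siblings. -/
def decode (ℓ r : ℕ) : Finset ℕ := if ℓ ∣ r then Finset.equivBitIndices (r / ℓ) else ∅

/-- The levels of the neighbours of the vertex `(j, n)` among its ancestors. -/
def up (ℓ c T : ℕ) : ℕ → ℕ → Finset ℕ
  | 0, _ => ∅
  | j + 1, n =>
    if decode ℓ (n % branching ℓ T) ⊆ insert j (up ℓ c T j (n / branching ℓ T)) ∧
        (decode ℓ (n % branching ℓ T)).card ≤ c then
      decode ℓ (n % branching ℓ T) else ∅

/-- The levels of the vertex `(j, n)` and of its neighbours among its ancestors. -/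
def trunk (ℓ c T j n : ℕ) : Finset ℕ := insert j (up ℓ c T j n)

/-- The ancestor of the vertex `(j, n)` on level `i`. -/
def ancestor (ℓ T j n i : ℕ) : ℕ × ℕ := (i, n / branching ℓ T ^ (j - i))

/-- The layered tree: each layer `{(j, n) | n : ℕ}` is a path, `(j, n)` is the parent of the
vertices `(j + 1, m)` with `m / branching ℓ T = n`, and each vertex is joined to its ancestors on
the levels in `up`. -/
def graph (ℓ c T : ℕ) : SimpleGraph (ℕ × ℕ) :=
  fromRel fun x y ↦ (x.1 = y.1 ∧ x.2 + 1 = y.2) ∨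
    (x.1 ∈ up ℓ c T y.1 y.2 ∧ x = ancestor ℓ T y.1 y.2 x.1)

theorem branching_pos (hℓ : 0 < ℓ) : 0 < branching ℓ T := by
  unfold branching; positivity

theorem decode_code (hℓ : 0 < ℓ) (A : Finset ℕ) : decode ℓ (ℓ * code A) = A := by
  rw [decode, if_pos (Dvd.intro _ rfl), Nat.mul_div_cancel_left _ hℓ, code,
    Equiv.apply_symm_apply]

theorem mul_code_lt (hℓ : 0 < ℓ) {A : Finset ℕ} (hA : A ⊆ Finset.range T) :
    ℓ * code A < branching ℓ T :=
  Nat.mul_lt_mul_of_pos_left (Nat.geomSum_lt le_rfl fun _ hi ↦ Finset.mem_range.1 (hA hi)) hℓ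

theorem up_succ_subset (j n : ℕ) :
    up ℓ c T (j + 1) n ⊆ trunk ℓ c T j (n / branching ℓ T) := by
  rw [up]
  split_ifs with h
  · exact h.1
  · exact Finset.empty_subset _

theorem card_up_le (j n : ℕ) : (up ℓ c T j n).card ≤ c := by
  cases j with
  | zero => simp [up]
  | succ j =>
    rw [up]
    split_ifs with h
    · exact h.2
    · simp

theorem lt_of_mem_up {i j n : ℕ} (h : i ∈ up ℓ c T j n) : i < j := by
  induction j generalizing n with
  | zero => simp [up] at h
  | succ j ih =>
    rcases Finset.mem_insert.1 (up_succ_subset j n h) with rfl | h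
    · exact Nat.lt_succ_self _
    · exact (ih h).trans (Nat.lt_succ_self _)

theorem mem_trunk_self (j n : ℕ) : j ∈ trunk ℓ c T j n := Finset.mem_insert_self _ _

theorem le_of_mem_trunk {i j n : ℕ} (h : i ∈ trunk ℓ c T j n) : i ≤ j := by
  rcases Finset.mem_insert.1 h with rfl | h
  · exact le_rfl
  · exact (lt_of_mem_up h).le

theorem dvd_of_mem_up {i j n : ℕ} (h : i ∈ up ℓ c T j n) : ℓ ∣ n := by
  cases j with
  | zero => simp [up] at h
  | succ j =>
    rw [up] at h
    split_ifs at h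
    · rw [decode] at h
      split_ifs at h with hd
      · exact (Nat.dvd_mod_iff (Dvd.intro _ rfl)).1 hd
      · simp at h
    · simp at h

/-- Every small subset of a trunk is the ancestor neighbourhood of a child. Both the lower bound on
treewidth and the cuts rest on this. -/
theorem up_child (hℓ : 0 < ℓ) {j n : ℕ} {A : Finset ℕ} (hA : A ⊆ trunk ℓ c T j n)
    (hAc : A.card ≤ c) (hAT : A ⊆ Finset.range T) :
    up ℓ c T (j + 1) (n * branching ℓ T + ℓ * code A) = A := by
  have hlt := mul_code_lt hℓ hAT
  have h1 : (n * branching ℓ T + ℓ * code A) % branching ℓ T = ℓ * code A := by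
    rw [Nat.mul_add_mod', Nat.mod_eq_of_lt hlt]
  have h2 : (n * branching ℓ T + ℓ * code A) / branching ℓ T = n := by
    rw [mul_comm, Nat.mul_add_div (branching_pos hℓ), Nat.div_eq_of_lt hlt, add_zero]
  rw [up, h1, h2, decode_code hℓ, if_pos ⟨hA, hAc⟩]

theorem ancestor_self (j n : ℕ) : ancestor ℓ T j n j = (j, n) := by simp [ancestor]

theorem ancestor_succ {i j : ℕ} (n : ℕ) (h : i ≤ j) :
    ancestor ℓ T (j + 1) n i = ancestor ℓ T j (n / branching ℓ T) i := by
  rw [ancestor, ancestor, Nat.succ_sub h, Nat.div_div_eq_div_mul, pow_succ']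

theorem mem_up_of_mem_trunk {i i' j n : ℕ} (hi : i ∈ trunk ℓ c T j n)
    (hi' : i' ∈ trunk ℓ c T j n) (h : i < i') :
    i ∈ up ℓ c T i' (n / branching ℓ T ^ (j - i')) := by
  induction j generalizing n with
  | zero =>
    have := le_of_mem_trunk hi'
    omega
  | succ j ih =>
    rcases Finset.mem_insert.1 hi' with rfl | hi'
    · rcases Finset.mem_insert.1 hi with rfl | hi
      · exact absurd h (lt_irrefl _)
      · simpa using hi
    · have hlt := lt_of_mem_up hi'
      rcases Finset.mem_insert.1 hi with rfl | hi
      · omega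
      · have := ih (up_succ_subset _ _ hi) (up_succ_subset _ _ hi')
        rwa [Nat.div_div_eq_div_mul, ← pow_succ',
          ← Nat.sub_add_comm (Nat.lt_succ_iff.1 hlt)] at this

theorem graph_adj_of_lt {x y : ℕ × ℕ} (h : x.1 < y.1) :
    (graph ℓ c T).Adj x y ↔ x.1 ∈ up ℓ c T y.1 y.2 ∧ x = ancestor ℓ T y.1 y.2 x.1 := by
  rw [graph, fromRel_adj]
  constructor
  · rintro ⟨-, (⟨h', -⟩ | h') | (⟨h', -⟩ | ⟨h', -⟩)⟩
    · exact absurd h' h.ne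
    · exact h'
    · exact absurd h' h.ne'
    · exact absurd (lt_of_mem_up h') (lt_asymm h)
  · exact fun h' ↦ ⟨fun he ↦ h.ne (congrArg Prod.fst he), Or.inl (Or.inr h')⟩

theorem graph_adj_of_eq {x y : ℕ × ℕ} (h : x.1 = y.1) :
    (graph ℓ c T).Adj x y ↔ x.2 + 1 = y.2 ∨ y.2 + 1 = x.2 := by
  rw [graph, fromRel_adj]
  constructor
  · rintro ⟨-, (⟨-, h'⟩ | ⟨h', -⟩) | (⟨-, h'⟩ | ⟨h', -⟩)⟩
    · exact Or.inl h'
    · exact absurd h (lt_of_mem_up h').ne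
    · exact Or.inr h'
    · exact absurd h (lt_of_mem_up h').ne'
  · intro h'
    refine ⟨fun he ↦ ?_, h'.imp (fun h' ↦ Or.inl ⟨h, h'⟩) (fun h' ↦ Or.inl ⟨h.symm, h'⟩)⟩
    have := congrArg Prod.snd he
    omega

/-- Trunks are cliques, since the ancestor neighbours of a vertex are always chosen inside the trunk
of its parent. -/
theorem graph_adj_ancestor {i i' j n : ℕ} (hi : i ∈ trunk ℓ c T j n)
    (hi' : i' ∈ trunk ℓ c T j n) (hne : i ≠ i') :
    (graph ℓ c T).Adj (ancestor ℓ T j n i) (ancestor ℓ T j n i') := by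
  wlog h : i < i' generalizing i i'
  · exact (this hi' hi hne.symm (lt_of_le_of_ne (not_lt.1 h) hne.symm)).symm
  rw [graph_adj_of_lt h]
  refine ⟨mem_up_of_mem_trunk hi hi' h, Prod.ext rfl ?_⟩
  have hj := le_of_mem_trunk hi'
  simp only [ancestor]
  rw [Nat.div_div_eq_div_mul, ← pow_add]
  congr 2
  omega

/-! ### Cliques and holes -/

theorem up_of_adj {x y : ℕ × ℕ} (h : (graph ℓ c T).Adj x y) (hle : y.1 ≤ x.1) :
    (y.1 ∈ up ℓ c T x.1 x.2 ∧ y = ancestor ℓ T x.1 x.2 y.1) ∨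
      y = (x.1, x.2 + 1) ∨ (0 < x.2 ∧ y = (x.1, x.2 - 1)) := by
  rcases hle.lt_or_eq with hlt | heq
  · exact Or.inl ((graph_adj_of_lt hlt).1 h.symm)
  · right
    rcases (graph_adj_of_eq heq).1 h.symm with h | h
    · exact Or.inr ⟨by omega, Prod.ext heq (by simp only; omega)⟩
    · exact Or.inl (Prod.ext heq h.symm)

theorem card_le_of_isClique (hℓ : 3 ≤ ℓ) (hc : 2 ≤ c) {s : Finset (ℕ × ℕ)}
    (hs : (graph ℓ c T).IsClique s) : s.card ≤ c + 1 := by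
  rcases s.eq_empty_or_nonempty with rfl | hne
  · simp
  obtain ⟨x, hx, hmax⟩ := s.exists_max_image Prod.fst hne
  have small : ∀ y ∈ s, y.1 = x.1 → up ℓ c T y.1 y.2 = ∅ → s.card ≤ c + 1 := by
    intro y hy hyx hup
    have hsub : s ⊆ {y, (y.1, y.2 + 1), (y.1, y.2 - 1)} := by
      intro z hz
      by_cases hzy : z = y
      · simp [hzy]
      · rcases up_of_adj (hs hy hz (Ne.symm hzy)) (hyx ▸ hmax z hz) with h | h | ⟨-, h⟩
        · simp [hup] at h
        · simp [← h]
        · simp [← h]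
    exact (Finset.card_le_card hsub).trans (Finset.card_le_three.trans (by omega))
  by_cases hx0 : up ℓ c T x.1 x.2 = ∅
  · exact small x hx rfl hx0
  by_cases h : ∃ y ∈ s, y ≠ x ∧ y.1 = x.1
  -- Adjacent vertices of a layer have consecutive positions, so they are not both divisible by `ℓ`;
  -- one has no ancestor neighbours.
  · obtain ⟨y, hy, hyx, hyl⟩ := h
    refine small y hy hyl ?_
    by_contra hy0
    obtain ⟨i, hi⟩ := Finset.nonempty_iff_ne_empty.2 hx0
    obtain ⟨i', hi'⟩ := Finset.nonempty_iff_ne_empty.2 hy0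
    have h1 := dvd_of_mem_up hi
    have h2 := dvd_of_mem_up hi'
    rcases (graph_adj_of_eq hyl).1 (hs hy hx hyx) with h | h
    · rw [← h] at h1
      have := Nat.le_of_dvd one_pos ((Nat.dvd_add_right h2).1 h1)
      omega
    · rw [← h] at h2
      have := Nat.le_of_dvd one_pos ((Nat.dvd_add_right h1).1 h2)
      omega
  · push Not at h
    have hsub : s ⊆ insert x ((up ℓ c T x.1 x.2).image (ancestor ℓ T x.1 x.2)) := by
      intro z hz
      by_cases hzx : z = x
      · simp [hzx]
      · rcases (hmax z hz).lt_or_eq with hlt | heq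
        · have := (graph_adj_of_lt hlt).1 (hs hz hx hzx)
          exact Finset.mem_insert_of_mem (Finset.mem_image.2 ⟨z.1, this.1, this.2.symm⟩)
        · exact absurd heq (h z hz hzx)
    exact (Finset.card_le_card hsub).trans ((Finset.card_insert_le _ _).trans
      (Nat.add_le_add_right (Finset.card_image_le.trans (card_up_le _ _)) 1))

theorem cycleGraph_exists_two_neighbors {m : ℕ} (hm : 4 ≤ m) (a : Fin m) :
    ∃ b b', (cycleGraph m).Adj a b ∧ (cycleGraph m).Adj a b' ∧ b ≠ b' ∧
      ¬ (cycleGraph m).Adj b b' := by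
  obtain ⟨m, rfl⟩ := Nat.exists_eq_add_of_le' hm
  have h1 : (1 : Fin (m + 4)) ≠ 0 := by simp
  have h2 : (1 + 1 : Fin (m + 4)) ≠ 0 := by
    simp [Fin.ext_iff, Fin.val_add, Nat.mod_eq_of_lt (show 2 < m + 4 by omega)]
  have h3 : (1 + 1 + 1 : Fin (m + 4)) ≠ 0 := by
    simp [Fin.ext_iff, Fin.val_add, Nat.mod_eq_of_lt (show 2 < m + 4 by omega),
      Nat.mod_eq_of_lt (show 3 < m + 4 by omega)]
  refine ⟨a + 1, a - 1, ?_, ?_, ?_, ?_⟩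
  · exact cycleGraph_adj.2 (Or.inr (by abel))
  · exact cycleGraph_adj.2 (Or.inl (by abel))
  · intro h
    have : (1 + 1 : Fin (m + 4)) = (a + 1) - (a - 1) := by abel
    exact h2 (by rw [this, h, sub_self])
  · intro h
    rcases cycleGraph_adj.1 h with h | h
    · have : (1 : Fin (m + 4)) = (a + 1) - (a - 1) - 1 := by abel
      exact h1 (by rw [this, h, sub_self])
    · have : (1 + 1 + 1 : Fin (m + 4)) = 1 - ((a - 1) - (a + 1)) := by abel
      exact h3 (by rw [this, h, sub_self])

theorem le_length_of_hole {m : ℕ} (hm : 4 ≤ m) (f : cycleGraph m ↪g graph ℓ c T) : ℓ ≤ m := by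
  have hnb := cycleGraph_exists_two_neighbors hm
  have : Nonempty (Fin m) := ⟨⟨0, by omega⟩⟩
  -- The extremal vertex: deepest layer first, then rightmost.
  obtain ⟨a, ha⟩ := Finite.exists_max fun a ↦ toLex (f a)
  have hlevel : ∀ b, (f b).1 ≤ (f a).1 := fun b ↦ by
    rcases (Prod.Lex.le_iff).1 (ha b) with h | h
    · exact h.le
    · exact h.1.le
  have hright : ∀ b, f b ≠ ((f a).1, (f a).2 + 1) := fun b hb ↦ by
    rcases (Prod.Lex.le_iff).1 (ha b) with h | h
    · exact h.ne (by simp [hb])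
    · have := h.2
      simp [hb] at this
  have hclique : ∀ b b', b ≠ b' →
      ((f b).1 ∈ up ℓ c T (f a).1 (f a).2 ∧ f b = ancestor ℓ T (f a).1 (f a).2 (f b).1) →
      ((f b').1 ∈ up ℓ c T (f a).1 (f a).2 ∧ f b' = ancestor ℓ T (f a).1 (f a).2 (f b').1) →
      (cycleGraph m).Adj b b' := by
    rintro b b' hne ⟨h1, h2⟩ ⟨h3, h4⟩
    rw [← f.map_adj_iff, h2, h4]
    refine graph_adj_ancestor (Finset.mem_insert_of_mem h1) (Finset.mem_insert_of_mem h3) ?_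
    exact fun h ↦ hne (f.injective (by rw [h2, h4, h]))
  have hstart : ℓ ∣ (f a).2 ∧ 0 < (f a).2 ∧ ∃ b, f b = ((f a).1, (f a).2 - 1) := by
    obtain ⟨b, b', hb, hb', hne, hnadj⟩ := hnb a
    rcases up_of_adj (f.map_adj_iff.2 hb) (hlevel b) with h | h | h
    · rcases up_of_adj (f.map_adj_iff.2 hb') (hlevel b') with h' | h' | h'
      · exact absurd (hclique b b' hne h h') hnadj
      · exact absurd h' (hright b')
      · exact ⟨dvd_of_mem_up h.1, h'.1, b', h'.2⟩
    · exact absurd h (hright b)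
    · rcases up_of_adj (f.map_adj_iff.2 hb') (hlevel b') with h' | h' | h'
      · exact ⟨dvd_of_mem_up h'.1, h.1, b, h.2⟩
      · exact absurd h' (hright b')
      · exact absurd (f.injective (h.2.trans h'.2.symm)) hne
  obtain ⟨hdvd, hpos, hb₁⟩ := hstart
  -- The `ℓ - 1` positions left of a multiple of `ℓ` have no ancestor neighbours, so on the deepest
  -- layer the hole can only continue along the path.
  have hstep : ∀ k, k < ℓ → ∃ b, f b = ((f a).1, (f a).2 - k) := by
    intro k
    induction k with
    | zero => exact fun _ ↦ ⟨a, rfl⟩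
    | succ k ih =>
      intro hk
      rcases Nat.eq_zero_or_pos k with rfl | hk0
      · exact hb₁
      obtain ⟨d, hd⟩ := ih (by omega)
      obtain ⟨b, b', hb, hb', hne, -⟩ := hnb d
      have hdl : (f d).1 = (f a).1 := by rw [hd]
      have hd2 : (f d).2 = (f a).2 - k := by rw [hd]
      have hle := Nat.le_of_dvd hpos hdvd
      have hup : ∀ i, i ∉ up ℓ c T (f d).1 (f d).2 := fun i hi ↦ by
        have h1 := dvd_of_mem_up hi
        rw [hd2] at h1
        have h2 := Nat.le_of_dvd hk0 ((Nat.dvd_sub_iff_right (by omega) hdvd).1 h1)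
        omega
      have hd3 : (f d).2 - 1 = (f a).2 - (k + 1) := by omega
      rw [← hd3, ← hdl]
      rcases up_of_adj (f.map_adj_iff.2 hb) (hdl ▸ hlevel b) with h | h | h
      · exact absurd h.1 (hup _)
      · rcases up_of_adj (f.map_adj_iff.2 hb') (hdl ▸ hlevel b') with h' | h' | h'
        · exact absurd h'.1 (hup _)
        · exact absurd (f.injective (h.trans h'.symm)) hne
        · exact ⟨b', h'.2⟩
      · exact ⟨b, h.2⟩
  choose g hg using hstep
  have hle := Nat.le_of_dvd hpos hdvd
  have hinj : Function.Injective fun k : Fin ℓ ↦ g k k.2 := by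
    intro k k' h
    have := congrArg (fun x ↦ (f x).2) h
    simp only [hg] at this
    ext
    have := k.2
    have := k'.2
    omega
  simpa using Fintype.card_le_of_injective _ hinj

/-! ### Large treewidth and a clique of size `c + 1` -/

theorem exists_mem_trunk (hℓ : 0 < ℓ) (hc : 0 < c) {i : ℕ} (hi : i < T) (k : ℕ) :
    ∃ n < branching ℓ T ^ k, i ∈ trunk ℓ c T (i + k) n := by
  induction k with
  | zero => exact ⟨0, by simp, mem_trunk_self _ _⟩
  | succ k ih =>
    obtain ⟨n, hn, hin⟩ := ih
    have hsub : ({i} : Finset ℕ) ⊆ Finset.range T := by simpa using hi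
    refine ⟨n * branching ℓ T + ℓ * code {i}, ?_, ?_⟩
    · have := mul_code_lt hℓ hsub
      rw [pow_succ]
      nlinarith
    · refine Finset.mem_insert_of_mem ?_
      rw [← add_assoc, up_child hℓ (by simpa using hin) (by simpa using Nat.succ_le_iff.2 hc) hsub]
      exact Finset.mem_singleton_self i

theorem exists_up_eq_range (hℓ : 0 < ℓ) {k : ℕ} (hk : k ≤ c) (hkT : k ≤ T) :
    ∃ n < branching ℓ T ^ k, up ℓ c T k n = Finset.range k := by
  induction k with
  | zero => exact ⟨0, by simp, rfl⟩
  | succ k ih =>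
    obtain ⟨n, hn, hup⟩ := ih (by omega) (by omega)
    have hsub : Finset.range (k + 1) ⊆ Finset.range T := by simpa using hkT
    refine ⟨n * branching ℓ T + ℓ * code (Finset.range (k + 1)), ?_, ?_⟩
    · have := mul_code_lt hℓ hsub
      rw [pow_succ]
      nlinarith
    · refine up_child hℓ ?_ (by simpa using hk) hsub
      rw [trunk, hup, Finset.range_add_one]

/-- The vertices of the first `T` layers with index less than `branching ℓ T ^ T`. -/
def box (ℓ T : ℕ) : Set (ℕ × ℕ) := Set.Iio T ×ˢ Set.Iio (branching ℓ T ^ T)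

theorem finite_box : (box ℓ T).Finite := (Set.finite_Iio _).prod (Set.finite_Iio _)

theorem connected_layer (hℓ : 0 < ℓ) (j : Fin T) :
    (((graph ℓ c T).induce (box ℓ T)).induce {x : box ℓ T | (x : ℕ × ℕ).1 = j}).Connected := by
  have hpos : 0 < branching ℓ T ^ T := Nat.pow_pos (branching_pos hℓ)
  rw [connected_iff_exists_forall_reachable]
  refine ⟨⟨⟨(j, 0), j.2, hpos⟩, rfl⟩, ?_⟩
  rintro ⟨⟨⟨i, n⟩, hi, hn⟩, rfl : i = j⟩
  induction n with
  | zero => rfl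
  | succ n ih =>
    refine (ih hi (Nat.lt_of_succ_lt hn)).trans (Adj.reachable ?_)
    exact (graph_adj_of_eq (x := (↑j, n)) (y := (↑j, n + 1)) rfl).2 (Or.inl rfl)

theorem le_treewidth_box_add_one (hℓ : 0 < ℓ) (hc : 0 < c) :
    (T : ℕ∞) ≤ ((graph ℓ c T).induce (box ℓ T)).treewidth + 1 := by
  have hpos : 0 < branching ℓ T ^ T := Nat.pow_pos (branching_pos hℓ)
  have := card_le_treewidth_add_one (G := (graph ℓ c T).induce (box ℓ T))
    (fun j : Fin T ↦ {x : box ℓ T | (x : ℕ × ℕ).1 = j}) (fun j ↦ connected_layer hℓ j) ?_ ?_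
  · simpa using this
  · intro i j hij
    rw [Set.disjoint_left]
    exact fun x hx hx' ↦ hij (Fin.ext (Eq.trans (Eq.symm hx) hx'))
  · intro i j hij
    wlog h : i < j generalizing i j
    · obtain ⟨u, hu, v, hv, huv⟩ := this j i hij.symm (lt_of_le_of_ne (not_lt.1 h) hij.symm)
      exact ⟨v, hv, u, hu, huv.symm⟩
    -- Position below `branching ℓ T ^ k` means that the ancestor on level `i` is `(i, 0)`.
    obtain ⟨k, hk⟩ := Nat.exists_eq_add_of_le h.le
    obtain ⟨n, hn, hin⟩ := exists_mem_trunk hℓ hc i.2 k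
    have hkT : branching ℓ T ^ k ≤ branching ℓ T ^ T :=
      Nat.pow_le_pow_right (branching_pos hℓ) (by omega)
    refine ⟨⟨(i, 0), i.2, hpos⟩, rfl, ⟨(j, n), j.2, hn.trans_le hkT⟩, rfl, ?_⟩
    refine (graph_adj_of_lt h).2 ⟨?_, Prod.ext rfl ?_⟩
    · rw [← hk] at hin
      exact (Finset.mem_insert.1 hin).resolve_left (Fin.val_ne_of_ne hij)
    · change 0 = n / branching ℓ T ^ ((j : ℕ) - i)
      rw [hk, Nat.add_sub_cancel_left, Nat.div_eq_of_lt hn]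

theorem exists_isClique_box (hℓ : 0 < ℓ) (hcT : c < T) :
    ∃ s : Finset (ℕ × ℕ), (s : Set (ℕ × ℕ)) ⊆ box ℓ T ∧ (graph ℓ c T).IsClique s ∧
      s.card = c + 1 := by
  obtain ⟨n, hn, hup⟩ := exists_up_eq_range (T := T) hℓ le_rfl hcT.le
  have htr : trunk ℓ c T c n = Finset.range (c + 1) := by rw [trunk, hup, Finset.range_add_one]
  refine ⟨(Finset.range (c + 1)).image (ancestor ℓ T c n), ?_, ?_, ?_⟩
  · intro x hx
    obtain ⟨i, hi, rfl⟩ := Finset.mem_image.1 (Finset.mem_coe.1 hx)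
    refine ⟨(Finset.mem_range_succ_iff.1 hi).trans_lt hcT, ?_⟩
    exact (Nat.div_le_self _ _).trans_lt (hn.trans_le
      (Nat.pow_le_pow_right (branching_pos hℓ) hcT.le))
  · intro x hx y hy hne
    obtain ⟨i, hi, rfl⟩ := Finset.mem_image.1 (Finset.mem_coe.1 hx)
    obtain ⟨i', hi', rfl⟩ := Finset.mem_image.1 (Finset.mem_coe.1 hy)
    exact graph_adj_ancestor (htr ▸ hi) (htr ▸ hi') fun h ↦ hne (by rw [h])
  · rw [Finset.card_image_of_injective _ fun i i' h ↦ congrArg Prod.fst h, Finset.card_range]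

/-! ### Small cuts in a set without cliques of size `c` -/

variable {S : Set (ℕ × ℕ)}

open Classical in
/-- The levels of those vertices of the trunk of `(j, n)` which belong to `S`. -/
noncomputable def levelsIn (ℓ c T : ℕ) (S : Set (ℕ × ℕ)) (j n : ℕ) : Finset ℕ :=
  (trunk ℓ c T j n).filter fun i ↦ ancestor ℓ T j n i ∈ S

/-- The vertices of the trunk of `(j, n)` which belong to `S`. -/
def trunkIn (ℓ c T : ℕ) (S : Set (ℕ × ℕ)) (j n : ℕ) : Set (ℕ × ℕ) :=
  ancestor ℓ T j n '' levelsIn ℓ c T S j n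

/-- The child of `(j, n)` joined exactly to the vertices in `trunkIn`. -/
noncomputable def child (ℓ c T : ℕ) (S : Set (ℕ × ℕ)) (j n : ℕ) : ℕ :=
  n * branching ℓ T + ℓ * code (levelsIn ℓ c T S j n)

/-- The vertices of `S` in the trunk of the `k`-th iterated `child` of `(j, n)`. -/
noncomputable def cutAux (ℓ c T : ℕ) (S : Set (ℕ × ℕ)) : ℕ → ℕ → ℕ → Set (ℕ × ℕ)
  | 0, j, n => trunkIn ℓ c T S j n
  | k + 1, j, n => cutAux ℓ c T S k (j + 1) (child ℓ c T S j n)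

/-- The vertices of `S` in the trunk of the iterated `child` of `(j, n)` on level `T`. They separate
the descendants of `(j, n)` to the left of that vertex from those to the right. -/
noncomputable def cut (ℓ c T : ℕ) (S : Set (ℕ × ℕ)) (j n : ℕ) : Set (ℕ × ℕ) :=
  cutAux ℓ c T S (T - j) j n

/-- `S` lives on the first `T` levels and contains no clique of size `c`. -/
structure Sparse (ℓ c T : ℕ) (S : Set (ℕ × ℕ)) : Prop where
  pos : 0 < ℓ
  level_lt : ∀ x ∈ S, x.1 < T
  card_lt : ∀ s : Finset (ℕ × ℕ), (s : Set (ℕ × ℕ)) ⊆ S → (graph ℓ c T).IsClique s → s.card < c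

theorem mem_levelsIn {i j n : ℕ} :
    i ∈ levelsIn ℓ c T S j n ↔ i ∈ trunk ℓ c T j n ∧ ancestor ℓ T j n i ∈ S := by
  classical
  exact Finset.mem_filter

theorem mem_trunkIn {x : ℕ × ℕ} {j n : ℕ} : x ∈ trunkIn ℓ c T S j n ↔
    x.1 ∈ trunk ℓ c T j n ∧ x ∈ S ∧ x = ancestor ℓ T j n x.1 := by
  constructor
  · rintro ⟨i, hi, rfl⟩
    have := mem_levelsIn.1 hi
    exact ⟨this.1, this.2, rfl⟩
  · rintro ⟨h1, h2, h3⟩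
    exact ⟨x.1, mem_levelsIn.2 ⟨h1, h3 ▸ h2⟩, h3.symm⟩

theorem mem_trunkIn_self {x : ℕ × ℕ} (hx : x ∈ S) : x ∈ trunkIn ℓ c T S x.1 x.2 :=
  mem_trunkIn.2 ⟨mem_trunk_self _ _, hx, (ancestor_self _ _).symm⟩

theorem levelsIn_subset_trunk (j n : ℕ) : levelsIn ℓ c T S j n ⊆ trunk ℓ c T j n :=
  fun _ hi ↦ (mem_levelsIn.1 hi).1

namespace Sparse

theorem levelsIn_subset_range (h : Sparse ℓ c T S) (j n : ℕ) :
    levelsIn ℓ c T S j n ⊆ Finset.range T :=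
  fun _ hi ↦ Finset.mem_range.2 (h.level_lt _ (mem_levelsIn.1 hi).2)

theorem card_levelsIn_lt (h : Sparse ℓ c T S) (j n : ℕ) : (levelsIn ℓ c T S j n).card < c := by
  have := h.card_lt ((levelsIn ℓ c T S j n).image (ancestor ℓ T j n)) ?_ ?_
  · rwa [Finset.card_image_of_injective _ fun i i' h ↦ congrArg Prod.fst h] at this
  · intro x hx
    obtain ⟨i, hi, rfl⟩ := Finset.mem_image.1 (Finset.mem_coe.1 hx)
    exact (mem_levelsIn.1 hi).2
  · intro x hx y hy hne
    obtain ⟨i, hi, rfl⟩ := Finset.mem_image.1 (Finset.mem_coe.1 hx)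
    obtain ⟨i', hi', rfl⟩ := Finset.mem_image.1 (Finset.mem_coe.1 hy)
    exact graph_adj_ancestor (mem_levelsIn.1 hi).1 (mem_levelsIn.1 hi').1
      fun h ↦ hne (by rw [h])

theorem encard_trunkIn_le (h : Sparse ℓ c T S) (j n : ℕ) :
    (trunkIn ℓ c T S j n).encard ≤ (c - 1 : ℕ) := by
  refine (Set.encard_image_le _ _).trans ?_
  rw [Set.encard_coe_eq_coe_finsetCard]
  exact_mod_cast Nat.le_sub_one_of_lt (h.card_levelsIn_lt j n)

theorem encard_cut_le (h : Sparse ℓ c T S) (j n : ℕ) :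
    (cut ℓ c T S j n).encard ≤ (c - 1 : ℕ) := by
  have : ∀ k j n, (cutAux ℓ c T S k j n).encard ≤ (c - 1 : ℕ) := fun k ↦ by
    induction k with
    | zero => exact h.encard_trunkIn_le
    | succ k ih => exact fun j n ↦ ih _ _
  exact this _ _ _

/-- This is where sparseness enters: the trunk vertices in `S` form a clique, hence are few enough
to be the whole ancestor neighbourhood of one child. -/
theorem up_child (h : Sparse ℓ c T S) (j n : ℕ) :
    up ℓ c T (j + 1) (child ℓ c T S j n) = levelsIn ℓ c T S j n :=
  LayeredTree.up_child h.pos (levelsIn_subset_trunk j n) (h.card_levelsIn_lt j n).le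
    (h.levelsIn_subset_range j n)

theorem child_div (h : Sparse ℓ c T S) (j n : ℕ) : child ℓ c T S j n / branching ℓ T = n := by
  rw [child, mul_comm, Nat.mul_add_div (branching_pos h.pos),
    Nat.div_eq_of_lt (mul_code_lt h.pos (h.levelsIn_subset_range j n)), add_zero]

theorem mem_trunkIn_child (h : Sparse ℓ c T S) {x : ℕ × ℕ} {j n : ℕ} (hx : x.1 ≤ j) :
    x ∈ trunkIn ℓ c T S (j + 1) (child ℓ c T S j n) ↔ x ∈ trunkIn ℓ c T S j n := by
  rw [mem_trunkIn, mem_trunkIn, trunk, h.up_child, ancestor_succ _ hx, h.child_div,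
    Finset.mem_insert, or_iff_right (by omega), mem_levelsIn]
  constructor
  · exact fun h ↦ ⟨h.1.1, h.2⟩
  · exact fun h ↦ ⟨⟨h.1, h.2.2 ▸ h.2.1⟩, h.2⟩

/-- Descending to the special child neither loses nor gains trunk vertices of `S` on the levels
already passed. -/
theorem mem_cutAux_iff (h : Sparse ℓ c T S) (k : ℕ) {x : ℕ × ℕ} {j n : ℕ} (hx : x.1 ≤ j) :
    x ∈ cutAux ℓ c T S k j n ↔ x ∈ trunkIn ℓ c T S j n := by
  induction k generalizing j n with
  | zero => rfl
  | succ k ih => rw [cutAux, ih (by omega), h.mem_trunkIn_child hx]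

theorem trunkIn_subset_cut (h : Sparse ℓ c T S) (j n : ℕ) :
    trunkIn ℓ c T S j n ⊆ cut ℓ c T S j n :=
  fun _ hx ↦ (h.mem_cutAux_iff _ (le_of_mem_trunk (mem_trunkIn.1 hx).1)).2 hx

theorem mem_cut_self (h : Sparse ℓ c T S) {x : ℕ × ℕ} (hx : x ∈ S) :
    x ∈ cut ℓ c T S x.1 x.2 :=
  h.trunkIn_subset_cut _ _ (mem_trunkIn_self hx)

theorem div_eq_of_mem_cutAux (h : Sparse ℓ c T S) {k : ℕ} {x : ℕ × ℕ} {j n : ℕ}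
    (hx : x ∈ cutAux ℓ c T S k j n) (hj : j ≤ x.1) : x.2 / branching ℓ T ^ (x.1 - j) = n := by
  have base : ∀ {n}, x.1 = j → x ∈ trunkIn ℓ c T S j n →
      x.2 / branching ℓ T ^ (x.1 - j) = n := by
    rintro n rfl hx
    have h2 := (mem_trunkIn.1 hx).2.2
    rw [ancestor_self] at h2
    simpa using congrArg Prod.snd h2
  induction k generalizing j n with
  | zero => exact base (le_antisymm (le_of_mem_trunk (mem_trunkIn.1 hx).1) hj) hx
  | succ k ih =>
    rcases hj.eq_or_lt with rfl | hlt
    · exact base rfl ((h.mem_cutAux_iff (k + 1) le_rfl).1 hx)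
    · have := ih hx hlt fun {n} he hx ↦ by
        have h2 := (mem_trunkIn.1 hx).2.2
        rw [he, ancestor_self] at h2
        simpa [he] using congrArg Prod.snd h2
      rw [show x.1 - j = x.1 - (j + 1) + 1 by omega, pow_succ, ← Nat.div_div_eq_div_mul, this,
        h.child_div]

theorem cut_eq_cut_child (j n : ℕ) (hj : j < T) :
    cut ℓ c T S j n = cut ℓ c T S (j + 1) (child ℓ c T S j n) := by
  rw [cut, cut, show T - j = T - (j + 1) + 1 by omega, cutAux]

/-- If `x` is on level at most `j`, trunks shrink correctly to the parent. Otherwise `x` descends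
both from `(j + 1, n)` and from the special child of `(j, n')`, so these coincide. -/
theorem mem_cut_div (h : Sparse ℓ c T S) {x : ℕ × ℕ} {j n n' : ℕ} (hj : j < T)
    (hx : x ∈ cut ℓ c T S (j + 1) n) (hx' : x ∈ cut ℓ c T S j n') :
    x ∈ cut ℓ c T S j (n / branching ℓ T) := by
  rcases le_or_gt x.1 j with hle | hlt
  · have h1 := mem_trunkIn.1 ((h.mem_cutAux_iff _ (by omega)).1 hx)
    refine h.trunkIn_subset_cut _ _ (mem_trunkIn.2 ⟨?_, h1.2.1, ?_⟩)
    · exact up_succ_subset _ _ ((Finset.mem_insert.1 h1.1).resolve_left (by omega))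
    · rw [← ancestor_succ _ hle]
      exact h1.2.2
  · have h1 := h.div_eq_of_mem_cutAux hx hlt
    have h2 := h.div_eq_of_mem_cutAux (cut_eq_cut_child j n' hj ▸ hx') hlt
    rw [← h1, h2, h.child_div]
    exact hx'

end Sparse

/-! ### The tree decomposition -/

/-- The number of `u` with `child j u < p`. -/
noncomputable def region (ℓ c T : ℕ) (S : Set (ℕ × ℕ)) (j p : ℕ) : ℕ :=
  if child ℓ c T S j (p / branching ℓ T) < p then p / branching ℓ T + 1 else p / branching ℓ T

/-- The union of the cuts of `(j, p - 1)` and `(j, p)`. -/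
noncomputable def pairCut (ℓ c T : ℕ) (S : Set (ℕ × ℕ)) (j p : ℕ) : Set (ℕ × ℕ) :=
  {x | x ∈ cut ℓ c T S j p ∨ ∃ n, n + 1 = p ∧ x ∈ cut ℓ c T S j n}

/-- The bag of the node `(j, p)`. -/
noncomputable def nodeBag (ℓ c T : ℕ) (S : Set (ℕ × ℕ)) : ℕ × ℕ → Set (ℕ × ℕ)
  | (0, p) => pairCut ℓ c T S 0 p
  | (j + 1, p) => pairCut ℓ c T S (j + 1) p ∪ pairCut ℓ c T S j (region ℓ c T S j p)

open Classical in
/-- The parent of the node `(j, p)`. -/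
noncomputable def nodeParent (ℓ c T : ℕ) (S : Set (ℕ × ℕ)) : ℕ × ℕ → ℕ × ℕ
  | (0, p) => (0, p - 1)
  | (j + 1, p) =>
    if 0 < p ∧ region ℓ c T S j (p - 1) = region ℓ c T S j p then (j + 1, p - 1)
    else (j, region ℓ c T S j p)

theorem pairCut_subset_nodeBag (j p : ℕ) : pairCut ℓ c T S j p ⊆ nodeBag ℓ c T S (j, p) := by
  cases j with
  | zero => exact subset_rfl
  | succ j => exact Set.subset_union_left

namespace Sparse

theorem child_lt (h : Sparse ℓ c T S) (j n : ℕ) :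
    child ℓ c T S j n < (n + 1) * branching ℓ T := by
  rw [add_mul, one_mul]
  exact Nat.add_lt_add_left (mul_code_lt h.pos (h.levelsIn_subset_range j n)) _

theorem le_child (j n : ℕ) : n * branching ℓ T ≤ child ℓ c T S j n := Nat.le_add_right _ _

theorem lt_region_iff (h : Sparse ℓ c T S) {j u p : ℕ} :
    u < region ℓ c T S j p ↔ child ℓ c T S j u < p := by
  have hM := branching_pos (T := T) h.pos
  rcases lt_trichotomy u (p / branching ℓ T) with hlt | heq | hgt
  · have h1 : child ℓ c T S j u < p := (h.child_lt j u).trans_le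
      ((Nat.mul_le_mul_right _ hlt).trans (Nat.div_mul_le_self _ _))
    refine iff_of_true ?_ h1
    rw [region]
    split_ifs <;> omega
  · rw [region, ← heq]
    split_ifs with h1 <;> simp [h1]
  · have h1 : p < child ℓ c T S j u :=
      ((Nat.div_lt_iff_lt_mul hM).1 hgt).trans_le (le_child j u)
    refine iff_of_false ?_ h1.not_gt
    rw [region]
    split_ifs <;> omega

theorem region_le (h : Sparse ℓ c T S) (j p : ℕ) : region ℓ c T S j p ≤ p := by
  by_contra hlt
  have h1 := h.lt_region_iff.1 (not_le.1 hlt)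
  have h2 := (Nat.le_mul_of_pos_right p (branching_pos (T := T) h.pos)).trans
    (le_child (c := c) (S := S) j p)
  omega

theorem region_eq_or (h : Sparse ℓ c T S) {j n p : ℕ} (hp : p = n ∨ n + 1 = p) :
    region ℓ c T S j p = n / branching ℓ T ∨ region ℓ c T S j p = n / branching ℓ T + 1 := by
  have hM := branching_pos (T := T) h.pos
  have h1 : n / branching ℓ T ≤ region ℓ c T S j p := by
    by_contra hlt
    have h2 := mt h.lt_region_iff.2 (lt_irrefl (region ℓ c T S j p))
    have h3 := (h.child_lt j (region ℓ c T S j p)).trans_le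
      ((Nat.mul_le_mul_right _ (not_le.1 hlt)).trans (Nat.div_mul_le_self _ _))
    omega
  have h2 : ¬ n / branching ℓ T + 1 < region ℓ c T S j p := by
    rw [h.lt_region_iff]
    have h3 := le_child (ℓ := ℓ) (c := c) (T := T) (S := S) j (n / branching ℓ T + 1)
    have h4 := (Nat.div_lt_iff_lt_mul hM).1 (Nat.lt_succ_self (n / branching ℓ T))
    rw [Nat.succ_eq_add_one] at h4
    omega
  omega

theorem exists_child_eq (h : Sparse ℓ c T S) {j n : ℕ}
    (hr : region ℓ c T S j n ≠ region ℓ c T S j (n + 1)) : ∃ u, child ℓ c T S j u = n := by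
  by_contra hne
  push Not at hne
  refine hr (eq_of_forall_lt_iff fun u ↦ ?_)
  rw [h.lt_region_iff, h.lt_region_iff]
  have := hne u
  omega

/-- A vertex in a cut of level `j + 1` that is in any cut of level `j` already lies on the boundary
of the region containing `p`. This keeps bags connected when passing up a level. -/
theorem mem_pairCut_region (h : Sparse ℓ c T S) {x : ℕ × ℕ} {j p n : ℕ} (hj : j < T)
    (hx : x ∈ pairCut ℓ c T S (j + 1) p) (hx' : x ∈ cut ℓ c T S j n) :
    x ∈ pairCut ℓ c T S j (region ℓ c T S j p) := by
  obtain ⟨m, hm, hxm⟩ : ∃ m, (p = m ∨ m + 1 = p) ∧ x ∈ cut ℓ c T S (j + 1) m := by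
    rcases hx with hx | ⟨m, hm, hx⟩
    · exact ⟨p, Or.inl rfl, hx⟩
    · exact ⟨m, Or.inr hm, hx⟩
  have h1 := h.mem_cut_div hj hxm hx'
  rcases h.region_eq_or (j := j) hm with h2 | h2
  · exact Or.inl (h2 ▸ h1)
  · exact Or.inr ⟨_, h2.symm, h1⟩

theorem mem_cut_of_le {x : ℕ × ℕ} {j : ℕ} (hx : ∃ n, x ∈ cut ℓ c T S j n) {j' : ℕ} (hj : j ≤ j') (hT : j' ≤ T) :
    ∃ n, x ∈ cut ℓ c T S j' n := by
  induction j', hj using Nat.le_induction with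
  | base => exact hx
  | succ k hk ih =>
    obtain ⟨n, hn⟩ := ih (by omega)
    exact ⟨_, cut_eq_cut_child k n hT ▸ hn⟩

/-- The first level on which `x` belongs to a cut, with the node of that level which comes first
among those whose bags contain `x`. -/
theorem exists_top (h : Sparse ℓ c T S) {x : ℕ × ℕ} (hx : x ∈ S) : ∃ t : ℕ × ℕ,
    t.1 ≤ x.1 ∧ t.2 ≤ x.2 ∧ x ∈ nodeBag ℓ c T S t ∧
    ∀ s : ℕ × ℕ, s.1 ≤ T → x ∈ nodeBag ℓ c T S s → s ≠ t →
      s ≠ (0, 0) ∧ x ∈ nodeBag ℓ c T S (nodeParent ℓ c T S s) := by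
  classical
  have hex : ∃ j n, x ∈ cut ℓ c T S j n := ⟨_, _, h.mem_cut_self hx⟩
  obtain ⟨n₀, hn₀⟩ := Nat.find_spec hex
  have hmin : ∀ {j n}, x ∈ cut ℓ c T S j n → Nat.find hex ≤ j :=
    fun hx ↦ Nat.find_min' hex ⟨_, hx⟩
  have hmin' : ∀ {j p}, x ∈ pairCut ℓ c T S j p → Nat.find hex ≤ j := by
    rintro j p (hx | ⟨n, -, hx⟩) <;> exact hmin hx
  have hle := hmin (h.mem_cut_self hx)
  generalize Nat.find hex = j₀ at *
  have huniq : ∀ {n}, x ∈ cut ℓ c T S j₀ n → n = n₀ := fun hn ↦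
    (h.div_eq_of_mem_cutAux hn hle).symm.trans (h.div_eq_of_mem_cutAux hn₀ hle)
  -- On its first level `x` is in a single cut, shared by the two consecutive nodes `n₀` and `n₀ +
  -- 1`.
  have hpair : ∀ {p}, x ∈ pairCut ℓ c T S j₀ p → (j₀, p) ≠ (j₀, n₀) → p = n₀ + 1 := by
    rintro p (hx | ⟨n, hn, hx⟩) hne
    · exact absurd (by rw [huniq hx]) hne
    · rw [← hn, huniq hx]
  have htop : x ∈ nodeBag ℓ c T S (j₀, n₀) := pairCut_subset_nodeBag _ _ (Or.inl hn₀)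
  refine ⟨(j₀, n₀), hle, ?_, htop, ?_⟩
  · rw [← h.div_eq_of_mem_cutAux hn₀ hle]
    exact Nat.div_le_self _ _
  rintro ⟨j, p⟩ hjT hs hne
  cases j with
  | zero =>
    obtain rfl : j₀ = 0 := Nat.le_zero.1 (hmin' hs)
    obtain rfl := hpair hs hne
    exact ⟨by simp, htop⟩
  | succ j =>
    refine ⟨by simp, ?_⟩
    by_cases hj : j₀ ≤ j
    · obtain ⟨n, hn⟩ := mem_cut_of_le ⟨n₀, hn₀⟩ hj (Nat.le_of_succ_le hjT)
      have hreg : x ∈ pairCut ℓ c T S j (region ℓ c T S j p) := by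
        rcases hs with hs | hs
        · exact h.mem_pairCut_region hjT hs hn
        · exact hs
      rw [nodeParent]
      split_ifs with hp
      · exact Or.inr (hp.2 ▸ hreg)
      · exact pairCut_subset_nodeBag _ _ hreg
    · rcases hs with hs | hs
      · obtain rfl : j₀ = j + 1 := by have := hmin' hs; omega
        obtain rfl := hpair hs hne
        rw [nodeParent, if_pos, Nat.add_sub_cancel]
        · exact htop
        · refine ⟨Nat.succ_pos _, ?_⟩
          -- A change of region just after `n₀` would make `n₀` a special child, whose cut is also
          -- one of level `j`, against the minimality of `j₀`.
          by_contra hr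
          obtain ⟨u, hu⟩ := h.exists_child_eq hr
          rw [Nat.add_sub_cancel] at hu
          rw [← hu, ← cut_eq_cut_child j u hjT] at hn₀
          exact hj (hmin hn₀)
      · exact absurd (hmin' hs) hj

theorem exists_mem_nodeBag_of_adj (h : Sparse ℓ c T S) {x y : ℕ × ℕ} (hx : x ∈ S) (hy : y ∈ S)
    (hxy : (graph ℓ c T).Adj x y) : ∃ z, (z = x ∨ z = y) ∧
      x ∈ nodeBag ℓ c T S z ∧ y ∈ nodeBag ℓ c T S z := by
  wlog hle : y.1 ≤ x.1 generalizing x y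
  · obtain ⟨z, hz, h1, h2⟩ := this hy hx hxy.symm (by omega)
    exact ⟨z, hz.symm, h2, h1⟩
  have hx' : x ∈ pairCut ℓ c T S x.1 x.2 := Or.inl (h.mem_cut_self hx)
  have hy' : y ∈ pairCut ℓ c T S y.1 y.2 := Or.inl (h.mem_cut_self hy)
  rcases up_of_adj hxy hle with ⟨h1, h2⟩ | h1 | ⟨h0, h1⟩
  · refine ⟨x, Or.inl rfl, pairCut_subset_nodeBag _ _ hx', pairCut_subset_nodeBag _ _ ?_⟩
    exact Or.inl (h.trunkIn_subset_cut _ _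
      (mem_trunkIn.2 ⟨Finset.mem_insert_of_mem h1, hy, h2⟩))
  · refine ⟨y, Or.inr rfl, pairCut_subset_nodeBag _ _ ?_, pairCut_subset_nodeBag _ _ hy'⟩
    rw [h1]
    exact Or.inr ⟨x.2, rfl, h.mem_cut_self hx⟩
  · refine ⟨x, Or.inl rfl, pairCut_subset_nodeBag _ _ hx', pairCut_subset_nodeBag _ _ ?_⟩
    refine Or.inr ⟨y.2, ?_, ?_⟩
    · rw [h1]
      exact Nat.sub_add_cancel h0
    · have := h.mem_cut_self hy
      rwa [show y.1 = x.1 by rw [h1]] at this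

theorem pairCut_subset (j p : ℕ) :
    pairCut ℓ c T S j p ⊆ cut ℓ c T S j p ∪ cut ℓ c T S j (p - 1) := by
  rintro x (hx | ⟨n, rfl, hx⟩)
  · exact Or.inl hx
  · exact Or.inr hx

theorem encard_pairCut_le (h : Sparse ℓ c T S) (j p : ℕ) :
    (pairCut ℓ c T S j p).encard ≤ (2 * (c - 1) : ℕ) := by
  refine (Set.encard_le_encard (pairCut_subset j p)).trans ((Set.encard_union_le _ _).trans ?_)
  rw [two_mul, Nat.cast_add]
  exact add_le_add (h.encard_cut_le _ _) (h.encard_cut_le _ _)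

theorem encard_nodeBag_le (h : Sparse ℓ c T S) (s : ℕ × ℕ) :
    (nodeBag ℓ c T S s).encard ≤ (4 * (c - 1) : ℕ) := by
  obtain ⟨_ | j, p⟩ := s
  · exact (h.encard_pairCut_le _ _).trans (Nat.cast_le.2 (by omega))
  · refine (Set.encard_union_le _ _).trans
      ((add_le_add (h.encard_pairCut_le _ _) (h.encard_pairCut_le _ _)).trans ?_)
    exact_mod_cast (by omega)

theorem treewidth_induce_le (h : Sparse ℓ c T S) {Q k : ℕ} (hQ : ∀ x ∈ S, x.2 ≤ Q)
    (hk : 4 * (c - 1) ≤ k + 1) : ((graph ℓ c T).induce S).treewidth ≤ k := by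
  have : Finite (Set.Iic (T, Q)) := (Set.finite_Iic _).to_subtype
  have hmem : ∀ x ∈ S, x ∈ Set.Iic (T, Q) := fun x hx ↦ ⟨(h.level_lt x hx).le, hQ x hx⟩
  have hparent : ∀ s ∈ Set.Iic (T, Q), nodeParent ℓ c T S s ∈ Set.Iic (T, Q) := by
    rintro ⟨_ | j, p⟩ ⟨h1, h2⟩
    · exact ⟨h1, (Nat.sub_le p 1).trans h2⟩
    · rw [nodeParent]
      split_ifs
      · exact ⟨h1, (Nat.sub_le p 1).trans h2⟩
      · exact ⟨Nat.le_of_succ_le h1, (h.region_le j p).trans h2⟩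
  choose! top htop using fun x hx ↦ h.exists_top (x := x) hx
  refine treewidth_le_of_parent (N := Set.Iic (T, Q))
    (parent := fun s ↦ ⟨nodeParent ℓ c T S s, hparent s s.2⟩)
    (root := ⟨(0, 0), Nat.zero_le _, Nat.zero_le _⟩)
    -- Lexicographic order: a parent lies to the left on the same level, or one level up.
    (depth := fun s ↦ s.1.1 * (Q + 1) + s.1.2) rfl ?_
    (fun s ↦ Subtype.val ⁻¹' nodeBag ℓ c T S s)
    (fun x ↦ ⟨top x, (htop x x.2).1.trans (h.level_lt x x.2).le,
      (htop x x.2).2.1.trans (hQ x x.2)⟩) (fun x ↦ (htop x x.2).2.2.1) ?_ ?_ ?_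
  · rintro ⟨⟨j, p⟩, h1, h2⟩ hne
    have hp : j = 0 → 0 < p := fun hj ↦ Nat.pos_of_ne_zero fun hp ↦ hne (by subst hj hp; rfl)
    cases j with
    | zero =>
      have := hp rfl
      simp only [nodeParent]
      omega
    | succ j =>
      have := h.region_le j p
      have h2 : p ≤ Q := h2
      simp only [nodeParent, add_mul]
      split_ifs <;> simp only [add_mul] <;> omega
  · intro x s hs hne
    have := (htop x x.2).2.2.2 s s.2.1 hs fun h ↦ hne (Subtype.ext h)
    exact ⟨fun h ↦ this.1 (congrArg Subtype.val h), this.2⟩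
  · intro x y hxy
    obtain ⟨z, hz, h1, h2⟩ := h.exists_mem_nodeBag_of_adj x.2 y.2 hxy
    exact ⟨⟨z, hz.elim (fun hz ↦ hz ▸ hmem _ x.2) (fun hz ↦ hz ▸ hmem _ y.2)⟩, h1, h2⟩
  · intro s
    rw [← Subtype.val_injective.encard_image]
    refine (Set.encard_le_encard (Set.image_preimage_subset _ _)).trans
      ((h.encard_nodeBag_le s).trans ?_)
    exact_mod_cast hk

end Sparse

end LayeredTree

/-! ### Complete bipartite and degenerate graphs -/

theorem cycleGraph_four_isIndContained {V : Type*} {G : SimpleGraph V} (a b : ℕ)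
    (e : G ≃g completeBipartiteGraph (Fin a) (Fin b)) (h : (2 : ℕ∞) ≤ G.treewidth) :
    cycleGraph 4 ⊴ G := by
  rw [treewidth_eq_of_iso e] at h
  -- A side with at most one vertex would be a vertex cover forcing treewidth at most 1.
  have hfew : ∀ A : Set (Fin a ⊕ Fin b), A.encard ≤ (1 : ℕ) →
      (∀ u v, (completeBipartiteGraph (Fin a) (Fin b)).Adj u v → u ∈ A ∨ v ∈ A) → False :=
    fun A hA hcov ↦ absurd (h.trans (treewidth_le_of_vertexCover A hA hcov)) (by decide)
  have ha : 2 ≤ a := by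
    by_contra ha
    refine hfew (Set.range Sum.inl) ?_ ?_
    · rw [← Set.image_univ, Sum.inl_injective.encard_image, Set.encard_univ]
      simp only [ENat.card_eq_coe_fintype_card, Fintype.card_fin]
      exact_mod_cast (by omega)
    · rintro (u | u) (v | v) huv <;> simp at huv ⊢
  have hb : 2 ≤ b := by
    by_contra hb
    refine hfew (Set.range Sum.inr) ?_ ?_
    · rw [← Set.image_univ, Sum.inr_injective.encard_image, Set.encard_univ]
      simp only [ENat.card_eq_coe_fintype_card, Fintype.card_fin]
      exact_mod_cast (by omega)
    · rintro (u | u) (v | v) huv <;> simp at huv ⊢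
  let f : Fin 4 → Fin a ⊕ Fin b :=
    ![.inl ⟨0, by omega⟩, .inr ⟨0, by omega⟩, .inl ⟨1, by omega⟩, .inr ⟨1, by omega⟩]
  refine ⟨RelEmbedding.trans ⟨⟨f, ?_⟩, ?_⟩ e.symm.toRelEmbedding⟩
  · intro i j
    fin_cases i <;> fin_cases j <;> simp [f]
  · intro i j
    change (completeBipartiteGraph _ _).Adj (f i) (f j) ↔ _
    fin_cases i <;> fin_cases j <;> simp [f, cycleGraph_adj] <;> decide

theorem IsDegenerate.cliqueFree {V : Type*} {G : SimpleGraph V} {d : ℕ} (h : G.IsDegenerate d) :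
    G.CliqueFree (d + 2) := by
  classical
  intro s hs
  have hne : (s : Set V).Nonempty := by
    rw [Finset.coe_nonempty, ← Finset.card_pos, hs.card_eq]
    omega
  obtain ⟨v, hv, hle⟩ := h s hne
  have hsub : ((s.erase v : Finset V) : Set V) ⊆ G.neighborSet v ∩ s := by
    intro w hw
    rw [Finset.mem_coe, Finset.mem_erase] at hw
    exact ⟨hs.isClique hv hw.2 hw.1.symm, hw.2⟩
  have := (Set.encard_le_encard hsub).trans hle
  rw [Set.encard_coe_eq_coe_finsetCard, Finset.card_erase_of_mem hv, hs.card_eq] at this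
  have : d + 2 - 1 ≤ d := by exact_mod_cast this
  omega

theorem treewidth_induce_le_of_card_le {V : Type*} {G : SimpleGraph V} (s : Finset V) {k : ℕ}
    (hs : s.card ≤ k + 1) : (G.induce (s : Set V)).treewidth ≤ k := by
  refine (treewidth_le_encard_sub_one _).trans (tsub_le_iff_right.2 ?_)
  rw [Set.encard_univ, ENat.card_coe_set_eq, Set.encard_coe_eq_coe_finsetCard]
  exact_mod_cast hs

theorem cliqueNum_eq {V : Type*} [Finite V] {G : SimpleGraph V} {k : ℕ}
    (hle : ∀ s : Finset V, G.IsClique s → s.card ≤ k) {s : Finset V} (hs : G.IsClique s)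
    (hk : s.card = k) : G.cliqueNum = k := by
  obtain ⟨t, ht⟩ := G.exists_isNClique_cliqueNum
  exact le_antisymm (ht.card_eq ▸ hle t ht.isClique) (hk ▸ hs.card_le_cliqueNum)

/-! ### The counterexamples -/

namespace LayeredTree

variable {ℓ c T : ℕ}

theorem treewidth_le_of_cliqueFree (hℓ : 0 < ℓ) {V : Type*} {G : SimpleGraph V}
    (f : G ↪g graph ℓ c T) (hf : ∀ v, f v ∈ box ℓ T) (hG : G.CliqueFree c) {k : ℕ}
    (hk : 4 * (c - 1) ≤ k + 1) : G.treewidth ≤ k := by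
  have hS : Sparse ℓ c T (Set.range f) := by
    refine ⟨hℓ, ?_, ?_⟩
    · rintro _ ⟨v, rfl⟩
      exact (hf v).1
    · intro s hsub hs
      by_contra hlt
      obtain ⟨s', rfl⟩ : ∃ s' : Finset V, s'.map f.toEmbedding = s := by
        refine ⟨s.preimage f f.injective.injOn, ?_⟩
        ext x
        simp only [Finset.mem_map, Finset.mem_preimage]
        constructor
        · rintro ⟨v, hv, rfl⟩
          exact hv
        · intro hx
          obtain ⟨v, rfl⟩ := hsub hx
          exact ⟨v, hx, rfl⟩
      rw [Finset.card_map, not_lt] at hlt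
      refine hG.mono hlt s' ⟨?_, rfl⟩
      intro u hu v hv hne
      exact f.map_adj_iff.1 (hs (by simpa using hu) (by simpa using hv) (f.injective.ne hne))
  have hle := hS.treewidth_induce_le (Q := branching ℓ T ^ T) (by
    rintro _ ⟨v, rfl⟩
    exact (hf v).2.le) hk
  exact (treewidth_le_of_injective (G := (graph ℓ c T).induce (Set.range f))
    ⟨fun v ↦ ⟨f v, v, rfl⟩, f.map_adj_iff.2⟩
    fun u v h ↦ f.injective (congrArg Subtype.val h)).trans hle

theorem exists_graph (hℓ : 5 ≤ ℓ) (hc : 2 ≤ c) (t : ℕ) :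
    ∃ (V : Type) (_ : Finite V) (G : SimpleGraph V),
      ((t : ℕ∞) ≤ G.treewidth ∧ (c ≤ t → G.treewidth = (t : ℕ∞))) ∧
      G.cliqueNum = c + 1 ∧
      (∀ m : ℕ, G.HasHoleOfLength m → ℓ ≤ m) ∧
      (∀ S : Set V, (G.induce S).IsCompleteBipartiteGraph →
        ¬ (2 : ℕ∞) ≤ (G.induce S).treewidth) ∧
      (∀ S : Set V, (G.induce S).CliqueFree c → ∀ k : ℕ, 4 * (c - 1) ≤ k + 1 →
        (G.induce S).treewidth ≤ k) := by
  classical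
  -- Large enough both for `T - 1 ≥ t` and for the clique, which needs `c < T`.
  set T := t + c + 1
  obtain ⟨s, hsT, hs, hsc⟩ := exists_isClique_box (ℓ := ℓ) (c := c) (T := T) (by omega) (by omega)
  have key : ∃ S : Set (ℕ × ℕ), S ⊆ box ℓ T ∧ (s : Set (ℕ × ℕ)) ⊆ S ∧
      ((t : ℕ∞) ≤ ((graph ℓ c T).induce S).treewidth ∧
        (c ≤ t → ((graph ℓ c T).induce S).treewidth = (t : ℕ∞))) := by
    have hbig : (t : ℕ∞) ≤ ((graph ℓ c T).induce (box ℓ T)).treewidth := by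
      have h1 := le_treewidth_box_add_one (ℓ := ℓ) (c := c) (T := T) (by omega) (by omega)
      have h2 : ((t : ℕ∞) + 1) ≤ (T : ℕ∞) := by exact_mod_cast (by omega)
      exact (ENat.add_le_add_iff_right (by simp)).1 (h2.trans h1)
    -- The clique on `c + 1` vertices has treewidth at most `c`, so vertices outside it can be
    -- deleted down to treewidth exactly `t` only when `c ≤ t`; otherwise the whole box is kept.
    by_cases hct : c ≤ t
    · obtain ⟨S, h1, h2, h3⟩ := exists_treewidth_induce_eq finite_box hsT
        (treewidth_induce_le_of_card_le s (by omega)) hbig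
      exact ⟨S, h2, h1, h3.ge, fun _ ↦ h3⟩
    · exact ⟨_, subset_rfl, hsT, hbig, fun h ↦ absurd h hct⟩
  obtain ⟨S, hST, hsS, htw⟩ := key
  have hfin : Finite S := (finite_box.subset hST).to_subtype
  have hhole : ∀ m : ℕ, ((graph ℓ c T).induce S).HasHoleOfLength m → ℓ ≤ m := by
    rintro m ⟨hm, ⟨f⟩⟩
    exact le_length_of_hole hm (f.trans (Embedding.induce S))
  refine ⟨S, hfin, (graph ℓ c T).induce S, htw, ?_, hhole, ?_, ?_⟩
  · have hsm : (s.subtype (· ∈ S)).map (Function.Embedding.subtype _) = s :=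
      Finset.subtype_map_of_mem hsS
    refine cliqueNum_eq ?_ (s := s.subtype (· ∈ S)) ?_ ?_
    · intro s' hs'
      rw [← Finset.card_map (Function.Embedding.subtype _)]
      refine card_le_of_isClique (ℓ := ℓ) (T := T) (by omega) hc ?_
      intro x hx y hy hne
      obtain ⟨u, hu, rfl⟩ := Finset.mem_map.1 (Finset.mem_coe.1 hx)
      obtain ⟨v, hv, rfl⟩ := Finset.mem_map.1 (Finset.mem_coe.1 hy)
      exact hs' hu hv fun h ↦ hne (by rw [h])
    · intro u hu v hv hne
      exact hs (by simpa using hu) (by simpa using hv) (Subtype.val_injective.ne hne)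
    · rw [← Finset.card_map (Function.Embedding.subtype _), hsm, hsc]
  · rintro S' ⟨a, b, ⟨e⟩⟩ h2
    obtain ⟨f⟩ := cycleGraph_four_isIndContained a b e h2
    have := hhole 4 ⟨le_rfl, ⟨f.trans (Embedding.induce S')⟩⟩
    omega
  · intro S' hS' k hk
    exact treewidth_le_of_cliqueFree (by omega)
      ((Embedding.induce S').trans (Embedding.induce S)) (fun v ↦ hST v.1.2) hS' hk

end LayeredTree

theorem treewidth_le_of_eq_top {V : Type*} [Finite V] {G : SimpleGraph V} {k : ℕ}
    (hk : G.cliqueNum ≤ k + 1) {S : Set V} (hS : G.induce S = ⊤) : (G.induce S).treewidth ≤ k := by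
  have hfin := S.toFinite
  have hcl : G.IsClique (hfin.toFinset : Set V) := by
    rw [hfin.coe_toFinset, ← induce_eq_top]
    exact hS
  have := treewidth_induce_le_of_card_le (G := G) hfin.toFinset (hcl.card_le_cliqueNum.trans hk)
  rwa [hfin.coe_toFinset] at this

theorem not_hajebiCliqueConjecture {c : ℕ} (hc : 2 ≤ c) : ¬ HajebiCliqueConjecture c := by
  intro h
  -- The value `4 * c` exceeds both `c`, for complete subgraphs, and `4 * (c - 1)`, for `K_c`-free
  -- ones.
  obtain ⟨N, hN⟩ := h (4 * c) (by omega)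
  obtain ⟨V, hV, G, ⟨htw, -⟩, hω, -, -, hG⟩ := LayeredTree.exists_graph (ℓ := 5) le_rfl hc N
  obtain ⟨S, hS, hS' | hS'⟩ := hN V G htw
  · have := treewidth_le_of_eq_top hω.le hS'
    rw [hS] at this
    have : 4 * c ≤ c := by exact_mod_cast this
    omega
  · have := hG S hS' (4 * (c - 1)) (by omega)
    rw [hS] at this
    have : 4 * c ≤ 4 * (c - 1) := by exact_mod_cast this
    omega

theorem not_hajebiDegenerateConjecture (d : ℕ) : ¬ HajebiDegenerateConjecture d := by
  intro h
  obtain ⟨N, hN⟩ := h (4 * (d + 2)) (by omega)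
  obtain ⟨V, hV, G, ⟨htw, -⟩, hω, -, hbip, hG⟩ :=
    LayeredTree.exists_graph (ℓ := 5) (c := d + 2) le_rfl (by omega) N
  obtain ⟨S, hS, hS' | hS' | hS'⟩ := hN V G htw
  · have := treewidth_le_of_eq_top hω.le hS'
    rw [hS] at this
    have : 4 * (d + 2) ≤ d + 2 := by exact_mod_cast this
    omega
  · refine hbip S hS' (hS ▸ ?_)
    exact_mod_cast (by omega)
  · have := hG S hS'.cliqueFree (4 * (d + 1)) (by omega)
    rw [hS] at this
    have : 4 * (d + 2) ≤ 4 * (d + 1) := by exact_mod_cast this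
    omega

end SimpleGraph

theorem mainTheorem3 :
    (∀ ℓ c t : ℕ, 5 ≤ ℓ → 2 ≤ c → 1 ≤ t →
      ∃ (V : Type) (_ : Finite V) (G : SimpleGraph V),
        ((t : ℕ∞) ≤ G.treewidth ∧ (c ≤ t → G.treewidth = (t : ℕ∞))) ∧
        G.cliqueNum = c + 1 ∧
        (∀ m : ℕ, G.HasHoleOfLength m → ℓ ≤ m) ∧
        (∀ S : Set V, (G.induce S).IsCompleteBipartiteGraph →
          ¬ (2 : ℕ∞) ≤ (G.induce S).treewidth) ∧
        (∀ S : Set V, (G.induce S).CliqueFree c →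
          (G.induce S).treewidth ≤ ((15 * (c + (ℓ + 1) * (c - 1) - 2) : ℕ) : ℕ∞)) ∧
        (∀ S : Set V, (G.induce S).IsDegenerate (c - 2) →
          (G.induce S).treewidth ≤ ((15 * (c + (ℓ + 1) * (c - 1) - 2) : ℕ) : ℕ∞))) ∧
    (∀ c : ℕ, 4 ≤ c → ¬ SimpleGraph.HajebiCliqueConjecture c) ∧
    (∀ d : ℕ, 2 ≤ d → ¬ SimpleGraph.HajebiDegenerateConjecture d) := by
  refine ⟨fun ℓ c t hℓ hc _ ↦ ?_,
    fun c hc ↦ SimpleGraph.not_hajebiCliqueConjecture (le_trans (by decide) hc),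
    fun d _ ↦ SimpleGraph.not_hajebiDegenerateConjecture d⟩
  obtain ⟨V, hV, G, htw, hω, hhole, hbip, hG⟩ := SimpleGraph.LayeredTree.exists_graph hℓ hc t
  -- The bound obtained is independent of `ℓ` and stronger than the required one.
  have hk : 4 * (c - 1) ≤ 15 * (c + (ℓ + 1) * (c - 1) - 2) + 1 := by
    have : 1 * (c - 1) ≤ (ℓ + 1) * (c - 1) := Nat.mul_le_mul_right _ (by omega)
    omega
  refine ⟨V, hV, G, htw, hω, hhole, hbip, fun S hS ↦ hG S hS _ hk, fun S hS ↦ hG S ?_ _ hk⟩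
  have := hS.cliqueFree
  rwa [Nat.sub_add_cancel hc] at this
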